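/- Let $m,n\ge 2$ be integers. An $m\times n$ chessboard with an integer written on each cell has the neighbour-sum property if the number on each cell equals the sum of the numbers on its neighbouring cells, where two distinct cells are neighbours if they share a common edge or a common vertex (the Moore neighbourhood). It is non-trivial if not all of its entries are zero. Then a non-trivial $m\times n$ chessboard with the neighbour-sum property exists if and only if $2\mid m+1$ and $3\mid n+1$, or $3\mid m+1$ and $2\mid n+1$. -/

import Mathlib

/-- The cells of an `m × n` chessboard: row index in `Fin m`, column index in `Fin n`. -/
abbrev Cell (m n : ℕ) : Type := Fin m × Fin n

/-- Two cells are (Moore) neighbours if they are distinct and share a common edge or a common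
vertex, i.e. both their row indices and their column indices differ by at most one. -/
def IsNeighbour {m n : ℕ} (a b : Cell m n) : Prop :=
  a ≠ b ∧ |(a.1 : ℤ) - (b.1 : ℤ)| ≤ 1 ∧ |(a.2 : ℤ) - (b.2 : ℤ)| ≤ 1

instance {m n : ℕ} (a b : Cell m n) : Decidable (IsNeighbour a b) :=
  inferInstanceAs (Decidable (_ ∧ _ ∧ _))

/-- An integer filling of the board has the neighbour-sum property if the number on each cell is
the sum of the numbers on the neighbouring cells. -/
def NeighbourSum {m n : ℕ} (X : Cell m n → ℤ) : Prop :=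
  ∀ a : Cell m n, X a = ∑ b with IsNeighbour a b, X b

/-! Adding the cell itself to its neighbours turns the condition into `A X B = 2 X`, with `A`, `B`
the looped path matrices. Left and right multiplication commute, so over ℂ there is a common
eigenvector, and 2 is a product of an eigenvalue of `A` and one of `B`. These have the form `1 + x +
x⁻¹` with `x ^ (2 * (m + 1)) = 1` and `x ^ 2 ≠ 1`. At a place above two, such a nonzero factor has
squared valuation at least `v 2`, unless it equals 2; equality is possible only for `1 ± √3`. So
either the factors are 1 and 2, or both are `1 ± √3`, which never multiply to 2
(`one_add_add_inv_mul_eq_two`). Eigenvalues 1 and 2 give the divisibilities by 2 and 3; conversely,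
products of their eigenvectors fill the board. -/

/-! ### Roots of unity at a place above two. -/

section Valuation

/-- There is a valuation on `ℂ` which is positive (multiplicatively: less than one) at two. -/
lemma exists_valuationSubring_two_lt_one :
    ∃ B : ValuationSubring ℂ, B.valuation 2 < 1 := by
  let f : ℤ →+* ℂ := Int.castRingHom ℂ
  have hI : Ideal.span {(2 : f.range)} ≠ ⊤ := by
    rw [Ne, Ideal.span_singleton_eq_top]
    rintro h
    obtain ⟨⟨_, c, rfl⟩, hc⟩ := h.exists_right_inv
    have h1 : (2 : ℂ) * (c : ℂ) = 1 := congrArg Subtype.val hc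
    have h2 : 2 * c = 1 := by exact_mod_cast h1
    omega
  obtain ⟨B, -, hB⟩ := Ideal.image_subset_nonunits_valuationSubring _ hI
  exact ⟨B, hB ⟨2, Ideal.subset_span rfl, rfl⟩⟩

variable {Γ : Type*} [LinearOrderedCommGroupWithZero Γ] (v : Valuation ℂ Γ)

lemma Valuation.map_eq_one_of_pow_eq_one {x : ℂ} {M : ℕ} (hM : M ≠ 0) (hx : x ^ M = 1) :
    v x = 1 := by
  have h : v x ^ M = 1 := by rw [← map_pow, hx, map_one]
  exact (pow_eq_one_iff_of_nonneg zero_le hM).1 h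

lemma Valuation.map_natCast_le_one (n : ℕ) : v (n : ℂ) ≤ 1 := by
  induction n with
  | zero => simp
  | succ n ih => push_cast; exact v.map_add_le ih (by simp)

lemma Valuation.map_one_sub_pow_le {z : ℂ} (hz : v z ≤ 1) (n : ℕ) :
    v (1 - z ^ n) ≤ v (1 - z) := by
  rw [← mul_neg_geom_sum z n, map_mul]
  refine mul_le_of_le_one_right' (v.map_sum_le fun i _ => ?_)
  rw [map_pow]
  exact pow_le_one' hz i

/-- Roots of unity of odd order are distinct modulo a place above two. -/
lemma Valuation.eq_one_of_odd_of_map_one_sub_lt (h2 : v 2 < 1) {z : ℂ} {M : ℕ} (hM : Odd M)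
    (hz : z ^ M = 1) (h : v (1 - z) < 1) : z = 1 := by
  by_contra hne
  have hz1 : v z = 1 := v.map_eq_one_of_pow_eq_one hM.pos.ne' hz
  have hsum : ∑ i ∈ Finset.range M, z ^ i = 0 := by
    have := mul_neg_geom_sum z M
    rw [hz, sub_self] at this
    exact (mul_eq_zero.1 this).resolve_left (sub_ne_zero.2 (Ne.symm hne))
  -- The powers of `z` sum to 0, so this sum is the odd number `M`, which is a unit at `v`.
  have hM1 : v (∑ i ∈ Finset.range M, (1 - z ^ i)) < 1 :=
    v.map_sum_lt one_ne_zero fun i _ => (v.map_one_sub_pow_le hz1.le i).trans_lt h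
  rw [Finset.sum_sub_distrib, hsum] at hM1
  obtain ⟨k, rfl⟩ := hM
  have hk : v (2 * (k : ℂ)) < 1 := by
    rw [map_mul]
    exact (mul_le_of_le_one_right' (v.map_natCast_le_one k)).trans_lt h2
  have := v.map_sub_lt hM1 hk
  simp at this

lemma Valuation.exists_two_pow_of_map_one_sub_lt (h2 : v 2 < 1) {z : ℂ} {M : ℕ} (hM : M ≠ 0)
    (hz : z ^ M = 1) (h : v (1 - z) < 1) : ∃ k : ℕ, z ^ 2 ^ k = 1 := by
  obtain ⟨k, N, hN, rfl⟩ := Nat.exists_eq_two_pow_mul_odd hM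
  refine ⟨k, v.eq_one_of_odd_of_map_one_sub_lt h2 hN (by rw [← pow_mul, hz]) ?_⟩
  exact (v.map_one_sub_pow_le (v.map_eq_one_of_pow_eq_one hM hz).le _).trans_lt h

lemma exists_two_pow_eq_neg_one {z : ℂ} (hz : z ≠ 1) {k : ℕ} (hk : z ^ 2 ^ k = 1) :
    ∃ j : ℕ, z ^ 2 ^ j = -1 := by
  induction k with
  | zero => simp at hk; exact absurd hk hz
  | succ k ih =>
    rw [pow_succ, pow_mul] at hk
    rcases eq_or_eq_neg_of_sq_eq_sq _ 1 (hk.trans (one_pow 2).symm) with h | h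
    · exact ih h
    · exact ⟨k, h⟩

lemma Valuation.map_eq_one_of_two_pow {z : ℂ} {j : ℕ} (hz : z ^ 2 ^ j = -1) : v z = 1 :=
  v.map_eq_one_of_pow_eq_one (M := 2 ^ j * 2) (by positivity) (by rw [pow_mul, hz]; norm_num)

/-- Each of `z` and `-z` is a power of the other, so `1 - z` and `1 + z` have the same valuation. -/
lemma Valuation.map_one_sub_sq {z : ℂ} {j : ℕ} (hz : z ^ 2 ^ (j + 1) = -1) :
    v (1 - z ^ 2) = v (1 - z) ^ 2 := by
  have key : ∀ w : ℂ, w ^ 2 ^ (j + 1) = -1 → v (1 + w) ≤ v (1 - w) := fun w hw => by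
    have h := v.map_one_sub_pow_le (v.map_eq_one_of_two_pow hw).le (2 ^ (j + 1) + 1)
    rwa [pow_succ w, hw, neg_one_mul, sub_neg_eq_add] at h
  have h1 := key z hz
  have h2 := key (-z) (by rw [← hz, pow_succ' 2 j, pow_mul, neg_sq, ← pow_mul])
  rw [sub_neg_eq_add, ← sub_eq_add_neg] at h2
  rw [show 1 - z ^ 2 = (1 - z) * (1 + z) by ring, map_mul, le_antisymm h1 h2, sq]

lemma Valuation.map_two_le_map_one_sub (h2 : v 2 < 1) {j : ℕ} : ∀ {z : ℂ}, z ^ 2 ^ j = -1 →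
    v 2 ≤ v (1 - z) ∧ v (1 - z) < 1 ∧ (z ≠ -1 → v 2 < v (1 - z)) := by
  induction j with
  | zero =>
    intro z hz
    obtain rfl : z = -1 := by simpa using hz
    norm_num
    exact h2
  | succ j ih =>
    intro z hz
    obtain ⟨h3, h4, -⟩ := ih (z := z ^ 2) (by rw [← pow_mul, ← pow_succ', hz])
    rw [v.map_one_sub_sq hz] at h3 h4
    have h5 : v (1 - z) < 1 := (pow_lt_one_iff two_ne_zero).1 h4
    have h0 : 0 < v (1 - z) := by
      rw [v.pos_iff, sub_ne_zero]
      rintro rfl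
      norm_num at hz
    have h6 : v (1 - z) ^ 2 < v (1 - z) := by
      rw [sq]
      exact mul_lt_of_lt_one_right h0 h5
    exact ⟨(h3.trans_lt h6).le, h5, fun _ => h3.trans_lt h6⟩

/-- The possible sizes of `1 + x + x⁻¹` at a place above two, for a root of unity `x`. -/
lemma Valuation.map_one_add_add_inv (h2 : v 2 < 1) {x : ℂ} {M : ℕ} (hM : M ≠ 0)
    (hx : x ^ M = 1) (hx2 : x ^ 2 ≠ 1) (hg : 1 + x + x⁻¹ ≠ 0) :
    x + x⁻¹ = 1 ∨ v 2 < v (1 + x + x⁻¹) ^ 2 ∨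
      ((x + x⁻¹) ^ 2 = 3 ∧ v 2 ≤ v (1 + x + x⁻¹) ^ 2) := by
  have hx0 : x ≠ 0 := by rintro rfl; simp [hM] at hx
  have hvx := v.map_eq_one_of_pow_eq_one hM hx
  have hx1 : 1 - x ≠ 0 := by
    rw [sub_ne_zero]; rintro rfl; simp at hx2
  -- Passing to `x ^ 3` reduces the bound to one on `1 - z` for a root of unity `z`.
  have hle : v (1 - x ^ 3) ≤ v (1 + x + x⁻¹) := by
    have h1 : 1 - x ^ 3 = x * (1 + x + x⁻¹) * (1 - x) := by field_simp; ring
    rw [h1, map_mul, map_mul, hvx, one_mul]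
    exact mul_le_of_le_one_right' (v.map_sub_le (by simp) hvx.le)
  have hz1 : x ^ 3 ≠ 1 := by
    intro h
    have h1 : 1 - x ^ 3 = x * (1 + x + x⁻¹) * (1 - x) := by field_simp; ring
    rw [h, sub_self] at h1
    exact mul_ne_zero (mul_ne_zero hx0 hg) hx1 h1.symm
  rcases lt_or_ge (v (1 - x ^ 3)) 1 with h | h
  swap
  · exact .inr (.inl (h2.trans_le (one_le_pow₀ (h.trans hle))))
  obtain ⟨k, hk⟩ := v.exists_two_pow_of_map_one_sub_lt h2 (z := x ^ 3) hM
    (by rw [← pow_mul, mul_comm, pow_mul, hx, one_pow]) h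
  obtain ⟨j, hj⟩ := exists_two_pow_eq_neg_one hz1 hk
  rcases j with _ | j
  · left
    have h3 : x ^ 3 = -1 := by simpa using hj
    have h4 : (x + 1) * (x ^ 2 - x + 1) = 0 := by linear_combination h3
    rcases mul_eq_zero.1 h4 with h5 | h5
    · exact absurd (by linear_combination (x - 1) * h5) hx2
    · field_simp
      linear_combination h5
  · right
    have hsq : v (1 - x ^ 3) ^ 2 ≤ v (1 + x + x⁻¹) ^ 2 := pow_le_pow_left₀ zero_le hle 2
    obtain ⟨h3, -, h4⟩ := v.map_two_le_map_one_sub h2 (z := (x ^ 3) ^ 2) (j := j)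
      (by rw [← pow_mul, ← pow_succ', hj])
    rw [v.map_one_sub_sq hj] at h3 h4
    by_cases h5 : (x ^ 3) ^ 2 = -1
    · have h6 : (x ^ 2 + 1) * (x ^ 4 - x ^ 2 + 1) = 0 := by linear_combination h5
      rcases mul_eq_zero.1 h6 with h7 | h7
      · left
        have : 1 + x + x⁻¹ = 1 := by field_simp; linear_combination h7
        rw [this]
        simpa using h2
      · right
        refine ⟨?_, h3.trans hsq⟩
        field_simp
        linear_combination h7
    · exact .inl ((h4 h5).trans_le hsq)

end Valuation

/-! ### The equation in roots of unity. -/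

lemma one_add_add_inv_mul_eq_two {x y : ℂ} {M N : ℕ} (hM : M ≠ 0) (hN : N ≠ 0)
    (hx : x ^ M = 1) (hy : y ^ N = 1) (hx2 : x ^ 2 ≠ 1) (hy2 : y ^ 2 ≠ 1)
    (h : (1 + x + x⁻¹) * (1 + y + y⁻¹) = 2) :
    (x + x⁻¹ = 1 ∧ y + y⁻¹ = 0) ∨ (x + x⁻¹ = 0 ∧ y + y⁻¹ = 1) := by
  obtain ⟨B, h2⟩ := exists_valuationSubring_two_lt_one
  set v := B.valuation
  have hgx : 1 + x + x⁻¹ ≠ 0 := left_ne_zero_of_mul (h ▸ two_ne_zero)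
  have hgy : 1 + y + y⁻¹ ≠ 0 := right_ne_zero_of_mul (h ▸ two_ne_zero)
  have hv : v 2 * v 2 = v (1 + x + x⁻¹) ^ 2 * v (1 + y + y⁻¹) ^ 2 := by
    rw [← mul_pow, ← map_mul v (1 + x + x⁻¹), h, sq]
  have h20 : 0 < v 2 := by rw [v.pos_iff]; exact two_ne_zero
  rcases v.map_one_add_add_inv h2 hM hx hx2 hgx with h1 | h1
  · left
    refine ⟨h1, ?_⟩
    linear_combination h / 2 - (1 + y + y⁻¹) / 2 * h1
  rcases v.map_one_add_add_inv h2 hN hy hy2 hgy with h3 | h3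
  · right
    refine ⟨?_, h3⟩
    linear_combination h / 2 - (1 + x + x⁻¹) / 2 * h3
  exfalso
  rcases h1 with h1 | ⟨hs, h1⟩
  · have h4 : v 2 ≤ v (1 + y + y⁻¹) ^ 2 := h3.elim le_of_lt And.right
    exact (mul_lt_mul h1 h4 h20 zero_le).ne hv
  rcases h3 with h3 | ⟨ht, h3⟩
  · exact (mul_lt_mul' h1 h3 zero_le (h20.trans_le h1)).ne hv
  -- Valuations do not exclude the boundary case, where both sums square to 3.
  have h5 : (1 + (x + x⁻¹)) * (1 + (y + y⁻¹)) = 2 := by rw [← h]; ring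
  generalize x + x⁻¹ = s at *
  generalize y + y⁻¹ = t at *
  rcases sq_eq_sq_iff_eq_or_eq_neg.1 (hs.trans ht.symm) with rfl | rfl
  · have h6 : s = -1 := by linear_combination h5 / 2 - hs / 2
    rw [h6] at hs
    norm_num at hs
  · have h6 : (-2 : ℂ) = 2 := by linear_combination h5 + ht
    norm_num at h6

/-! ### Eigenvalues of the looped path. -/

section PathMatrix

/-- The adjacency matrix of the path on `m` vertices with a loop added at every vertex. -/
def loopedPathMatrix (R : Type*) [Zero R] [One R] (m : ℕ) : Matrix (Fin m) (Fin m) R :=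
  Matrix.of fun i j => if |(i : ℤ) - (j : ℤ)| ≤ 1 then 1 else 0

lemma loopedPathMatrix_transpose (R : Type*) [Zero R] [One R] (m : ℕ) :
    (loopedPathMatrix R m).transpose = loopedPathMatrix R m := by
  ext i j
  simp [loopedPathMatrix, abs_sub_comm]

/-- Indices are shifted by one so that the zeros at 0 and `m + 1` absorb the two end rows. -/
lemma loopedPathMatrix_mulVec {R : Type*} [Ring R] {m : ℕ} (u : ℕ → R) (h0 : u 0 = 0)
    (hm : u (m + 1) = 0) (i : Fin m) :
    (loopedPathMatrix R m).mulVec (fun k => u (k + 1)) i = u i + u (i + 1) + u (i + 2) := by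
  have hsplit : ∀ k : Fin m, loopedPathMatrix R m i k * u (k + 1) =
      (if (k : ℕ) + 1 = i then u (k + 1) else 0) + (if (k : ℕ) = i then u (k + 1) else 0) +
        (if (k : ℕ) = i + 1 then u (k + 1) else 0) := by
    intro k
    simp only [loopedPathMatrix, Matrix.of_apply, abs_le]
    split_ifs <;> first | omega | simp
  have hi := i.2
  rw [Matrix.mulVec, dotProduct]
  simp only [hsplit, Finset.sum_add_distrib]
  rw [Fin.sum_univ_eq_sum_range (fun k => if k + 1 = (i : ℕ) then u (k + 1) else 0) m,
    Fin.sum_univ_eq_sum_range (fun k => if k = (i : ℕ) then u (k + 1) else 0) m,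
    Fin.sum_univ_eq_sum_range (fun k => if k = (i : ℕ) + 1 then u (k + 1) else 0) m]
  congr 1
  · congr 1
    · obtain hi0 | ⟨j, hj⟩ : (i : ℕ) = 0 ∨ ∃ j, (i : ℕ) = j + 1 :=
        (Nat.eq_zero_or_eq_succ_pred _).imp_right fun h => ⟨_, h⟩
      · simp [hi0, h0]
      · rw [hj] at hi ⊢
        simp [show j < m by omega]
    · simp
  · rw [Finset.sum_ite_eq']
    split_ifs with h
    · rfl
    · rw [Finset.mem_range] at h
      rw [show (i : ℕ) + 2 = m + 1 by omega, hm]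

lemma exists_add_inv_eq (c : ℂ) : ∃ x : ℂ, x ≠ 0 ∧ x + x⁻¹ = c := by
  obtain ⟨s, hs⟩ := IsAlgClosed.exists_pow_nat_eq (c ^ 2 - 4) (n := 2) two_pos
  have hprod : (c + s) / 2 * ((c - s) / 2) = 1 := by linear_combination -hs / 4
  refine ⟨(c + s) / 2, left_ne_zero_of_mul (hprod ▸ one_ne_zero), ?_⟩
  rw [inv_eq_of_mul_eq_one_right hprod]
  ring

/-- A nonzero solution of the recurrence `u (k + 2) = (x + x⁻¹) u (k + 1) - u k` which vanishes at
both ends forces `x` to be a root of unity. -/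
lemma pow_eq_one_of_recurrence {u : ℕ → ℂ} {m : ℕ} {x : ℂ} (hx : x ≠ 0) (h0 : u 0 = 0)
    (hm : u (m + 1) = 0) (hrec : ∀ i < m, u (i + 2) = (x + x⁻¹) * u (i + 1) - u i)
    (hne : ∃ i ≤ m, u i ≠ 0) : x ^ (2 * (m + 1)) = 1 ∧ x ^ 2 ≠ 1 := by
  -- This is `u k = u 1 * (x ^ k - x⁻¹ ^ k) / (x - x⁻¹)` without denominators, hence valid also for
  -- `x ^ 2 = 1`.
  have hsum : ∀ k ≤ m, u (k + 1) * x ^ k = u 1 * ∑ i ∈ Finset.range (k + 1), (x ^ 2) ^ i ∧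
      u k * x ^ k = u 1 * x * ∑ i ∈ Finset.range k, (x ^ 2) ^ i := by
    intro k hk
    induction k with
    | zero => simp [h0]
    | succ k ih =>
      obtain ⟨h1, h2⟩ := ih (by omega)
      have h3 : u (k + 1) * x ^ (k + 1) =
          u 1 * x * ∑ i ∈ Finset.range (k + 1), (x ^ 2) ^ i := by
        linear_combination x * h1
      refine ⟨?_, h3⟩
      rw [hrec k (by omega), Finset.sum_range_succ]
      have h4 : (x + x⁻¹) * x = x ^ 2 + 1 := by field_simp
      rw [Finset.sum_range_succ] at h1 ⊢
      linear_combination (exp := 1) u (k + 1) * x ^ k * h4 + (x ^ 2 + 1) * h1 - x * h2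
  have hu1 : u 1 ≠ 0 := by
    rintro h1
    obtain ⟨i, hi, hui⟩ := hne
    have := (hsum i hi).2
    rw [h1, zero_mul, zero_mul] at this
    exact mul_ne_zero hui (pow_ne_zero _ hx) this
  have hz : ∑ i ∈ Finset.range (m + 1), (x ^ 2) ^ i = 0 := by
    have := (hsum m le_rfl).1
    rw [hm, zero_mul] at this
    exact (mul_eq_zero.1 this.symm).resolve_left hu1
  constructor
  · have := mul_neg_geom_sum (x ^ 2) (m + 1)
    rw [hz, mul_zero] at this
    rw [pow_mul]
    linear_combination this
  · intro h
    rw [h] at hz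
    simp only [one_pow, Finset.sum_const, Finset.card_range, nsmul_eq_mul, mul_one] at hz
    exact Nat.cast_ne_zero.2 m.succ_ne_zero hz

lemma exists_root_of_loopedPathMatrix_mulVec {m : ℕ} {v : Fin m → ℂ} {c : ℂ} (hv : v ≠ 0)
    (h : (loopedPathMatrix ℂ m).mulVec v = c • v) :
    ∃ x : ℂ, x ^ (2 * (m + 1)) = 1 ∧ x ^ 2 ≠ 1 ∧ c = 1 + x + x⁻¹ := by
  obtain ⟨x, hx, hc⟩ := exists_add_inv_eq (c - 1)
  let u : ℕ → ℂ := fun k => if h : 1 ≤ k ∧ k ≤ m then v ⟨k - 1, by omega⟩ else 0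
  have h0 : u 0 = 0 := by simp [u]
  have hm : u (m + 1) = 0 := by simp [u]
  have huv : v = fun k : Fin m => u (k + 1) := by
    ext k
    have hk := k.2
    simp [u]
  have hrec : ∀ i < m, u (i + 2) = (x + x⁻¹) * u (i + 1) - u i := by
    intro i hi
    have h1 := congrFun h ⟨i, hi⟩
    rw [huv, loopedPathMatrix_mulVec u h0 hm] at h1
    simp only [Pi.smul_apply, smul_eq_mul] at h1
    linear_combination h1 - u (i + 1) * hc
  obtain ⟨i, hi⟩ := Function.ne_iff.1 hv
  obtain ⟨h1, h2⟩ := pow_eq_one_of_recurrence hx h0 hm hrec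
    ⟨i + 1, i.2, by rw [huv] at hi; exact hi⟩
  exact ⟨x, h1, h2, by linear_combination -hc⟩

end PathMatrix

/-! ### The board as a matrix equation. -/

lemma neighbourSum_iff {m n : ℕ} (X : Cell m n → ℤ) :
    NeighbourSum X ↔ loopedPathMatrix ℤ m * Matrix.of (fun i j => X (i, j)) *
      loopedPathMatrix ℤ n = 2 • Matrix.of (fun i j => X (i, j)) := by
  have hcell : ∀ a : Cell m n, (loopedPathMatrix ℤ m * Matrix.of (fun i j => X (i, j)) *
      loopedPathMatrix ℤ n) a.1 a.2 = X a + ∑ b with IsNeighbour a b, X b := by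
    intro a
    have h1 : (loopedPathMatrix ℤ m * Matrix.of (fun i j => X (i, j)) *
        loopedPathMatrix ℤ n) a.1 a.2 = ∑ b : Cell m n,
          if |(a.1 : ℤ) - (b.1 : ℤ)| ≤ 1 ∧ |(a.2 : ℤ) - (b.2 : ℤ)| ≤ 1 then X b else 0 := by
      rw [← loopedPathMatrix_transpose ℤ n, Fintype.sum_prod_type_right]
      simp only [Matrix.mul_apply, Matrix.transpose_apply, Finset.sum_mul]
      refine Finset.sum_congr rfl fun j _ => Finset.sum_congr rfl fun i _ => ?_
      simp only [loopedPathMatrix, Matrix.of_apply]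
      split_ifs <;> simp_all
    have h2 : X a = ∑ b, if b = a then X b else 0 := by simp
    rw [h1, Finset.sum_filter, h2, ← Finset.sum_add_distrib]
    refine Finset.sum_congr rfl fun b _ => ?_
    by_cases hb : b = a
    · subst hb
      simp [IsNeighbour]
    · simp [IsNeighbour, hb, Ne.symm hb]
  constructor
  · intro h
    ext i j
    rw [hcell (i, j), ← h (i, j)]
    simp [two_mul]
  · intro h a
    have h1 := hcell a
    rw [h] at h1
    simp only [Matrix.smul_apply, Matrix.of_apply, Prod.mk.eta, two_smul] at h1
    linarith

/-- A matrix equation `A X B = d X` has a solution which is an eigenvector of both the left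
multiplication by `A` and the right multiplication by `B`. -/
lemma exists_common_eigenvector {m n : ℕ} (A : Matrix (Fin m) (Fin m) ℂ)
    (B : Matrix (Fin n) (Fin n) ℂ) (d : ℂ) {X : Matrix (Fin m) (Fin n) ℂ} (hX : X ≠ 0)
    (h : A * X * B = d • X) :
    ∃ Y : Matrix (Fin m) (Fin n) ℂ, Y ≠ 0 ∧ ∃ a b : ℂ, A * Y = a • Y ∧ Y * B = b • Y ∧
      a * b = d := by
  have step : ∀ (f : Module.End ℂ (Matrix (Fin m) (Fin n) ℂ))
      (W : Submodule ℂ (Matrix (Fin m) (Fin n) ℂ)), W ≠ ⊥ → (∀ Y ∈ W, f Y ∈ W) →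
        ∃ a : ℂ, ∃ Y ∈ W, Y ≠ 0 ∧ f Y = a • Y := by
    intro f W hW hf
    have := Submodule.nontrivial_iff_ne_bot.2 hW
    obtain ⟨a, ha⟩ := Module.End.exists_eigenvalue (f.restrict hf)
    obtain ⟨⟨Y, hYW⟩, hY⟩ := ha.exists_hasEigenvector
    refine ⟨a, Y, hYW, fun h0 => hY.2 (Subtype.ext h0), ?_⟩
    exact congrArg Subtype.val hY.apply_eq_smul
  let L : Module.End ℂ (Matrix (Fin m) (Fin n) ℂ) :=
    { toFun := fun Y => A * Y
      map_add' := Matrix.mul_add A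
      map_smul' := fun c Y => Matrix.mul_smul A c Y }
  let R : Module.End ℂ (Matrix (Fin m) (Fin n) ℂ) :=
    { toFun := fun Y => Y * B
      map_add' := fun Y Z => Matrix.add_mul Y Z B
      map_smul' := fun c Y => Matrix.smul_mul c Y B }
  let W : Submodule ℂ (Matrix (Fin m) (Fin n) ℂ) := LinearMap.ker (R * L - d • 1)
  have hWmem : ∀ Y, Y ∈ W ↔ A * Y * B = d • Y := fun Y => by
    simp [W, L, R, sub_eq_zero]
  have hW : W ≠ ⊥ := fun hbot => hX ((Submodule.mem_bot ℂ).1 (hbot ▸ (hWmem X).2 h))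
  obtain ⟨a, Y, hYW, hY0, hYa⟩ := step L W hW fun Y hY => by
    rw [hWmem] at hY ⊢
    change A * (A * Y) * B = d • (A * Y)
    rw [Matrix.mul_assoc, hY, Matrix.mul_smul]
  -- `R` preserves this eigenspace of `L` because it commutes with `L`.
  let W' : Submodule ℂ (Matrix (Fin m) (Fin n) ℂ) := W ⊓ LinearMap.ker (L - a • 1)
  have hW'mem : ∀ Z, Z ∈ W' ↔ A * Z * B = d • Z ∧ A * Z = a • Z := fun Z => by
    rw [Submodule.mem_inf, hWmem]
    simp [L, sub_eq_zero]
  have hW' : W' ≠ ⊥ := fun hbot => hY0 ((Submodule.mem_bot ℂ).1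
    (hbot ▸ (hW'mem Y).2 ⟨(hWmem Y).1 hYW, hYa⟩))
  obtain ⟨b, Z, hZW, hZ0, hZb⟩ := step R W' hW' fun Z hZ => by
    rw [hW'mem] at hZ ⊢
    change A * (Z * B) * B = d • (Z * B) ∧ A * (Z * B) = a • (Z * B)
    rw [← Matrix.mul_assoc, hZ.1, Matrix.smul_mul, ← hZ.1, hZ.2, Matrix.smul_mul]
    exact ⟨rfl, rfl⟩
  obtain ⟨h1, h2⟩ := (hW'mem Z).1 hZW
  refine ⟨Z, hZ0, a, b, h2, hZb, ?_⟩
  have hZb' : Z * B = b • Z := hZb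
  rw [h2, Matrix.smul_mul, hZb', smul_smul] at h1
  exact smul_left_injective ℂ hZ0 h1

lemma exists_roots_of_mul_mul_eq_two_smul {m n : ℕ} {X : Matrix (Fin m) (Fin n) ℂ} (hX : X ≠ 0)
    (h : loopedPathMatrix ℂ m * X * loopedPathMatrix ℂ n = (2 : ℂ) • X) :
    ∃ x y : ℂ, x ^ (2 * (m + 1)) = 1 ∧ y ^ (2 * (n + 1)) = 1 ∧ x ^ 2 ≠ 1 ∧ y ^ 2 ≠ 1 ∧
      (1 + x + x⁻¹) * (1 + y + y⁻¹) = 2 := by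
  obtain ⟨Y, hY, a, b, hA, hB, hab⟩ := exists_common_eigenvector _ _ _ hX h
  obtain ⟨i, j, hij⟩ : ∃ i j, Y i j ≠ 0 := by
    by_contra! hc
    exact hY (Matrix.ext hc)
  -- A nonzero column of `Y` is an eigenvector on the left, a nonzero row one on the right.
  obtain ⟨x, hx, hx2, rfl⟩ := exists_root_of_loopedPathMatrix_mulVec (v := fun k => Y k j)
    (Function.ne_iff.2 ⟨i, hij⟩) (funext fun k => congrFun (congrFun hA k) j)
  obtain ⟨y, hy, hy2, rfl⟩ := exists_root_of_loopedPathMatrix_mulVec (v := Y i)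
    (c := b) (Function.ne_iff.2 ⟨j, hij⟩) (by
      rw [← loopedPathMatrix_transpose, Matrix.mulVec_transpose]
      exact congrFun hB i)
  exact ⟨x, y, hx, hy, hx2, hy2, hab⟩

/-! ### Divisibility from the order of the squared root. -/

lemma two_dvd_of_add_inv_eq_zero {y : ℂ} {k : ℕ} (hk : k ≠ 0) (hy : y ^ (2 * k) = 1) (hy2 : y ^ 2 ≠ 1)
    (h : y + y⁻¹ = 0) : 2 ∣ k := by
  have hy0 : y ≠ 0 := by rintro rfl; simp [hk] at hy
  have h1 : y ^ 2 = -1 := by field_simp at h; linear_combination h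
  rw [← orderOf_eq_prime (x := y ^ 2) (p := 2) (by rw [h1]; norm_num) hy2]
  exact orderOf_dvd_of_pow_eq_one (by rw [← pow_mul, hy])

lemma three_dvd_of_add_inv_eq_one {x : ℂ} {k : ℕ} (hx : x ^ (2 * k) = 1) (hx2 : x ^ 2 ≠ 1)
    (h : x + x⁻¹ = 1) : 3 ∣ k := by
  have hx0 : x ≠ 0 := by rintro rfl; simp at h
  have h1 : x ^ 2 - x + 1 = 0 := by field_simp at h; linear_combination h
  have : Fact (Nat.Prime 3) := ⟨Nat.prime_three⟩
  rw [← orderOf_eq_prime (x := x ^ 2) (p := 3)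
    -- The multiplier is `(x ^ 3 - 1) * (x + 1)`, the cofactor of `x ^ 2 - x + 1` in `x ^ 6 - 1`.
    (by linear_combination (x ^ 4 + x ^ 3 - x - 1) * h1) hx2]
  exact orderOf_dvd_of_pow_eq_one (by rw [← pow_mul, hx])

/-! ### Construction of a filling. -/

lemma exists_loopedPathMatrix_mulVec_eq_self {m : ℕ} (hm : 0 < m) (h : 2 ∣ m + 1) :
    ∃ v : Fin m → ℤ, v ≠ 0 ∧ (loopedPathMatrix ℤ m).mulVec v = v := by
  -- This is `sin (k π / 2)`, so `u k + u (k + 2) = 0`.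
  let u : ℕ → ℤ := fun k => if k % 4 = 1 then 1 else if k % 4 = 3 then -1 else 0
  refine ⟨fun k => u (k + 1), Function.ne_iff.2 ⟨⟨0, hm⟩, by simp [u]⟩, funext fun i => ?_⟩
  rw [loopedPathMatrix_mulVec u (by simp [u]) (by simp only [u]; split_ifs <;> omega)]
  simp only [u]
  split_ifs <;> omega

lemma exists_loopedPathMatrix_mulVec_eq_two_smul {m : ℕ} (hm : 0 < m) (h : 3 ∣ m + 1) :
    ∃ v : Fin m → ℤ, v ≠ 0 ∧ (loopedPathMatrix ℤ m).mulVec v = 2 • v := by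
  -- This is `sin (k π / 3)` rescaled to integers, so `u k + u (k + 2) = u (k + 1)`.
  let u : ℕ → ℤ := fun k => if k % 3 = 0 then 0 else if k % 6 < 3 then 1 else -1
  refine ⟨fun k => u (k + 1), Function.ne_iff.2 ⟨⟨0, hm⟩, by simp [u]⟩, funext fun i => ?_⟩
  rw [loopedPathMatrix_mulVec u (by simp [u]) (by simp only [u]; split_ifs <;> omega)]
  simp only [u, Pi.smul_apply, nsmul_eq_mul]
  split_ifs <;> omega

lemma exists_neighbourSum_of_mulVec {m n : ℕ} {v : Fin m → ℤ} {w : Fin n → ℤ} {a b : ℤ}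
    (hv : v ≠ 0) (hw : w ≠ 0) (hva : (loopedPathMatrix ℤ m).mulVec v = a • v)
    (hwb : (loopedPathMatrix ℤ n).mulVec w = b • w) (hab : a * b = 2) :
    ∃ X : Cell m n → ℤ, NeighbourSum X ∧ X ≠ 0 := by
  refine ⟨fun c => v c.1 * w c.2, (neighbourSum_iff _).2 ?_, ?_⟩
  · change loopedPathMatrix ℤ m * Matrix.vecMulVec v w * loopedPathMatrix ℤ n =
      2 • Matrix.vecMulVec v w
    rw [Matrix.mul_vecMulVec, Matrix.vecMulVec_mul, hva, ← Matrix.mulVec_transpose,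
      loopedPathMatrix_transpose, hwb, Matrix.smul_vecMulVec, Matrix.vecMulVec_smul, smul_smul,
      hab]
    rfl
  · obtain ⟨i, hi⟩ := Function.ne_iff.1 hv
    obtain ⟨j, hj⟩ := Function.ne_iff.1 hw
    exact Function.ne_iff.2 ⟨(i, j), mul_ne_zero hi hj⟩

theorem mainTheorem3 (m n : ℕ) (hm : 2 ≤ m) (hn : 2 ≤ n) :
    (∃ X : Cell m n → ℤ, NeighbourSum X ∧ X ≠ 0) ↔
      (2 ∣ m + 1 ∧ 3 ∣ n + 1) ∨ (3 ∣ m + 1 ∧ 2 ∣ n + 1) := by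
  constructor
  · rintro ⟨X, hX, hX0⟩
    have hmap : ∀ k, (loopedPathMatrix ℤ k).map (Int.castRingHom ℂ) = loopedPathMatrix ℂ k := by
      intro k
      ext i j
      simp [loopedPathMatrix, apply_ite (Int.cast : ℤ → ℂ)]
    have h := congrArg (fun Y => Y.map (Int.castRingHom ℂ)) ((neighbourSum_iff X).1 hX)
    simp only [Matrix.map_mul, hmap] at h
    obtain ⟨⟨i, j⟩, hij⟩ := Function.ne_iff.1 hX0
    obtain ⟨x, y, hx, hy, hx2, hy2, hxy⟩ := exists_roots_of_mul_mul_eq_two_smul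
      (X := (Matrix.of fun i j => X (i, j)).map (Int.castRingHom ℂ))
      (fun h0 => hij (by simpa using congrFun (congrFun h0 i) j))
      (h.trans (by ext i j; simp))
    rcases one_add_add_inv_mul_eq_two (by positivity) (by positivity) hx hy hx2 hy2 hxy with
      ⟨h1, h2⟩ | ⟨h1, h2⟩
    · exact .inr ⟨three_dvd_of_add_inv_eq_one hx hx2 h1, two_dvd_of_add_inv_eq_zero (Nat.succ_ne_zero _) hy hy2 h2⟩
    · exact .inl ⟨two_dvd_of_add_inv_eq_zero (Nat.succ_ne_zero _) hx hx2 h1, three_dvd_of_add_inv_eq_one hy hy2 h2⟩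
  · rintro (⟨h2, h3⟩ | ⟨h3, h2⟩)
    · obtain ⟨v, hv0, hv⟩ := exists_loopedPathMatrix_mulVec_eq_self (by omega) h2
      obtain ⟨w, hw0, hw⟩ := exists_loopedPathMatrix_mulVec_eq_two_smul (by omega) h3
      exact exists_neighbourSum_of_mulVec (a := 1) (b := 2) hv0 hw0 (by simpa using hv)
        (by simpa using hw) (by norm_num)
    · obtain ⟨w, hw0, hw⟩ := exists_loopedPathMatrix_mulVec_eq_self (by omega) h2
      obtain ⟨v, hv0, hv⟩ := exists_loopedPathMatrix_mulVec_eq_two_smul (by omega) h3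
      exact exists_neighbourSum_of_mulVec (a := 2) (b := 1) hv0 hw0 (by simpa using hv)
        (by simpa using hw) (by norm_num)
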